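/- Let $K$ be a field and $m,k\ge 0$. Let $A=K[a_1,\dots,a_m]$ and $P=A[x_1,\dots,x_k]$, and grade $P$ over $\mathbb{Z}$ by giving the elements of $A$ degree $0$ and $x_i$ degree $w_i$, where $w_1,\dots,w_k$ are positive integers. Let $I\subseteq P$ be a homogeneous ideal with $I\cap A=\{0\}$ (then $I\subseteq\langle x_1,\dots,x_k\rangle$), and let $R=P/I$. For a $K$-algebra $S$ and a maximal ideal $\mathfrak{m}$ of $S$ with $S/\mathfrak{m}=K$, put $\mathrm{Cot}_{\mathfrak{m}}(S)=\mathfrak{m}/\mathfrak{m}^2$. For a local $K$-algebra $S$ with maximal ideal $\mathfrak{m}$ and residue field $K$, put $\mathrm{edim}(S)=\dim_K\mathrm{Cot}_{\mathfrak{m}}(S)$ and $\mathrm{ecod}(S)=\mathrm{edim}(S)-\dim(S)$. Let $\Gamma=(\gamma_1,\dots,\gamma_m)\in K^m$. Let $\mathfrak{M}_{\Gamma_0}\subset P$ be the maximal ideal of the point $\Gamma_0=(\gamma_1,\dots,\gamma_m,0,\dots,0)\in K^{m+k}$, let $R_{\Gamma_0}$ be the localization of $R$ at $\mathfrak{M}_{\Gamma_0}/I$,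 and let $d_{\Gamma_0}=\dim(R_{\Gamma_0})$. Let $I_\Gamma$ be the ideal of $K[X]=K[x_1,\dots,x_k]$ generated by the polynomials obtained from the elements of $I$ by substituting $a_1\mapsto\gamma_1,\dots,a_m\mapsto\gamma_m$, let $R_{F_\Gamma}$ be the localization of $K[X]/I_\Gamma$ (the coordinate ring of the fiber over $\Gamma$) at $\langle X\rangle/I_\Gamma$, and let $d_{F_\Gamma}=\dim(R_{F_\Gamma})$. Then: (a) \begin{align*} d_{\Gamma_0}-m\;\le\; d_{F_\Gamma} &=\dim_K\bigl(\mathrm{Cot}_{\langle X\rangle/I_\Gamma}(K[X]/I_\Gamma)\bigr)-\mathrm{ecod}(R_{F_\Gamma})\\ &=\dim_K\bigl(\mathrm{Cot}_{\mathfrak{M}_{\Gamma_0}/I}(R)\bigr)-m-\mathrm{ecod}(R_{F_\Gamma})\\ &=\mathrm{edim}(R_{\Gamma_0})-m-\mathrm{ecod}(R_{F_\Gamma})\\ &=d_{\Gamma_0}+\mathrm{ecod}(R_{\Gamma_0})-m-\mathrm{ecod}(R_{F_\Gamma}). \end{align*} (b) $0\le\mathrm{ecod}(R_{F_\Gamma})\le\mathrm{ecod}(R_{\Gamma_0})$.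 -/

import Mathlib

open MvPolynomial

noncomputable section

/-! ### Invariants of local algebras -/

/-- The Krull dimension of a ring as a natural number. It is meaningful for rings of finite Krull
dimension, in particular for Noetherian local rings, see `coe_localDim`. -/
def localDim (S : Type*) [CommRing S] : ℕ :=
  ((ringKrullDim S).unbotD 0).toNat

/-- For a Noetherian local ring, `localDim` is the Krull dimension. -/
theorem coe_localDim (S : Type*) [CommRing S] [IsNoetherianRing S] [IsLocalRing S] :
    (localDim S : WithBot ℕ∞) = ringKrullDim S := by
  have h1 : ringKrullDim S ≠ ⊤ := ringKrullDim_ne_top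
  have h2 : ringKrullDim S ≠ ⊥ := ringKrullDim_ne_bot
  unfold localDim
  revert h1 h2
  generalize ringKrullDim S = d
  intro h1 h2
  cases d with
  | bot => exact absurd rfl h2
  | coe e =>
    cases e with
    | top => exact absurd rfl h1
    | coe n => rfl

/-- The `K`-dimension of the cotangent space `𝔪 / 𝔪²` of a `K`-algebra at an ideal `𝔪`. -/
def cotDim (K : Type*) [Field K] {S : Type*} [CommRing S] [Algebra K S] (𝔪 : Ideal S) : ℕ :=
  Module.finrank K 𝔪.Cotangent

/-- The embedding dimension `dim_K (𝔪 / 𝔪²)` of a local `K`-algebra `(S, 𝔪)` with residue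
field `K`. -/
def edim (K : Type*) [Field K] (S : Type*) [CommRing S] [Algebra K S] [IsLocalRing S] : ℕ :=
  cotDim K (IsLocalRing.maximalIdeal S)

/-- The embedding codimension `edim S - dim S` of a local `K`-algebra with residue field `K`. -/
def ecod (K : Type*) [Field K] (S : Type*) [CommRing S] [Algebra K S] [IsLocalRing S] : ℤ :=
  (edim K S : ℤ) - (localDim S : ℤ)

/-! ### Positive `A`-algebras -/

/-- The polynomial ring `A = K[a₁, …, a_m]`. -/
abbrev BaseRing (K : Type*) [Field K] (m : ℕ) : Type _ := MvPolynomial (Fin m) K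

/-- The polynomial ring `P = A[x₁, …, x_k]` over `A = K[a₁, …, a_m]`. -/
abbrev TotalRing (K : Type*) [Field K] (m k : ℕ) : Type _ := MvPolynomial (Fin k) (BaseRing K m)

section
attribute [local instance] MvPolynomial.weightedGradedAlgebra

/-- The data presenting a positive `A`-algebra `R = P / I`: weights `w₁, …, w_k > 0` for the
indeterminates `x₁, …, x_k` (the elements of `A` have degree zero), and an ideal `I` of `P` which
is homogeneous for the resulting `ℤ`-grading and satisfies `I ∩ A = {0}`. -/
structure PositiveAlgebra (K : Type*) [Field K] (m k : ℕ) where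
  weight : Fin k → ℤ
  weight_pos : ∀ i, 0 < weight i
  ideal : Ideal (TotalRing K m k)
  homogeneous : ideal.IsHomogeneous (weightedHomogeneousSubmodule (BaseRing K m) weight)
  inter_base : ideal.comap (C : BaseRing K m →+* TotalRing K m k) = ⊥

end

namespace PositiveAlgebra

variable {K : Type*} [Field K] {m k : ℕ}

/-- The ideal `I` is contained in `⟨x₁, …, x_k⟩`. -/
theorem constantCoeff_eq_zero (D : PositiveAlgebra K m k) {f : TotalRing K m k}
    (hf : f ∈ D.ideal) : constantCoeff f = 0 := by
  have h := weightedHomogeneousComponent_mem_of_mem (BaseRing K m) D.weight D.homogeneous hf 0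
  have h0 : weightedHomogeneousComponent D.weight 0 f = C (constantCoeff f) := by
    classical
    ext1 d
    rw [coeff_weightedHomogeneousComponent, coeff_C, constantCoeff_eq]
    by_cases hd : d = 0
    · subst hd; simp
    · have hpos : Finsupp.weight D.weight d ≠ 0 := by
        obtain ⟨i, hi⟩ : ∃ i, d i ≠ 0 := by
          by_contra! hcon
          exact hd (Finsupp.ext hcon)
        rw [Finsupp.weight_apply, Finsupp.sum_fintype _ _ (by simp)]
        refine (Finset.sum_pos' (fun j _ => ?_) ⟨i, Finset.mem_univ i, ?_⟩).ne'
        · exact nsmul_nonneg (D.weight_pos j).le _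
        · exact nsmul_pos (D.weight_pos i) hi
      rw [if_neg hpos, if_neg (Ne.symm hd)]
  rw [h0] at h
  have h' : constantCoeff f ∈ D.ideal.comap (C : BaseRing K m →+* TotalRing K m k) := h
  rwa [D.inter_base, Ideal.mem_bot] at h'

/-- The `K`-algebra `R = P / I`. -/
def CoordRing (D : PositiveAlgebra K m k) : Type _ := TotalRing K m k ⧸ D.ideal

instance (D : PositiveAlgebra K m k) : CommRing D.CoordRing :=
  inferInstanceAs (CommRing (TotalRing K m k ⧸ D.ideal))

instance (D : PositiveAlgebra K m k) : Algebra K D.CoordRing :=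
  inferInstanceAs (Algebra K (TotalRing K m k ⧸ D.ideal))

/-- The canonical epimorphism `P → R = P / I`. -/
def quotMk (D : PositiveAlgebra K m k) : TotalRing K m k →+* D.CoordRing :=
  Ideal.Quotient.mk D.ideal

/-- Evaluation of polynomials in `P` at the zero point `Γ₀ = (γ₁, …, γ_m, 0, …, 0)`. -/
def evalZeroPoint (k : ℕ) (Γ : Fin m → K) : TotalRing K m k →+* K :=
  (eval Γ).comp (eval (0 : Fin k → BaseRing K m))

/-- The maximal ideal `𝔐_{Γ₀}` of `P` corresponding to the zero point `Γ₀` over `Γ`. -/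
def zeroPointIdeal (k : ℕ) (Γ : Fin m → K) : Ideal (TotalRing K m k) :=
  RingHom.ker (evalZeroPoint k Γ)

/-- The maximal ideal `𝔐_{Γ₀} / I` of `R = P / I`. -/
def zeroPoint (D : PositiveAlgebra K m k) (Γ : Fin m → K) : Ideal D.CoordRing :=
  (zeroPointIdeal k Γ).map D.quotMk

instance zeroPoint_isMaximal (D : PositiveAlgebra K m k) (Γ : Fin m → K) :
    (D.zeroPoint Γ).IsMaximal := by
  have hs : Function.Surjective (evalZeroPoint k Γ) := fun c => ⟨C (C c), by simp [evalZeroPoint]⟩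
  have hM : (zeroPointIdeal k Γ).IsMaximal := RingHom.ker_isMaximal_of_surjective _ hs
  have hle : D.ideal ≤ zeroPointIdeal k Γ := by
    intro f hf
    have h := D.constantCoeff_eq_zero hf
    have h2 : eval (0 : Fin k → BaseRing K m) f = constantCoeff f := by
      rw [← eval_zero]
    rw [zeroPointIdeal, RingHom.mem_ker, evalZeroPoint, RingHom.comp_apply, h2, h, map_zero]
  exact Ideal.IsMaximal.map_of_surjective_of_ker_le (f := D.quotMk) Ideal.Quotient.mk_surjective
    (by exact (Ideal.mk_ker (I := D.ideal)).trans_le hle)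

/-- The local ring `R_{Γ₀}` of the zero point over `Γ`. -/
abbrev ZeroPointRing (D : PositiveAlgebra K m k) (Γ : Fin m → K) : Type _ :=
  Localization.AtPrime (D.zeroPoint Γ)

/-- The fiber ideal `I_Γ ⊆ K[x₁, …, x_k]`, generated by the polynomials obtained from the elements
of `I` by the substitution `a₁ ↦ γ₁, …, a_m ↦ γ_m`. -/
def fiberIdeal (D : PositiveAlgebra K m k) (Γ : Fin m → K) : Ideal (MvPolynomial (Fin k) K) :=
  D.ideal.map (MvPolynomial.map (eval Γ))

/-- The coordinate ring `K[X] / I_Γ` of the fiber over `Γ`. -/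
def FiberCoordRing (D : PositiveAlgebra K m k) (Γ : Fin m → K) : Type _ :=
  MvPolynomial (Fin k) K ⧸ D.fiberIdeal Γ

instance (D : PositiveAlgebra K m k) (Γ : Fin m → K) : CommRing (D.FiberCoordRing Γ) :=
  inferInstanceAs (CommRing (MvPolynomial (Fin k) K ⧸ D.fiberIdeal Γ))

instance (D : PositiveAlgebra K m k) (Γ : Fin m → K) : Algebra K (D.FiberCoordRing Γ) :=
  inferInstanceAs (Algebra K (MvPolynomial (Fin k) K ⧸ D.fiberIdeal Γ))

/-- The canonical epimorphism `K[X] → K[X] / I_Γ`. -/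
def fiberMk (D : PositiveAlgebra K m k) (Γ : Fin m → K) :
    MvPolynomial (Fin k) K →+* D.FiberCoordRing Γ :=
  Ideal.Quotient.mk (D.fiberIdeal Γ)

/-- The maximal ideal `⟨X⟩ / I_Γ` of the fiber at its origin. -/
def fiberOrigin (D : PositiveAlgebra K m k) (Γ : Fin m → K) : Ideal (D.FiberCoordRing Γ) :=
  (Ideal.span (Set.range (X : Fin k → MvPolynomial (Fin k) K))).map (D.fiberMk Γ)

instance fiberOrigin_isMaximal (D : PositiveAlgebra K m k) (Γ : Fin m → K) :
    (D.fiberOrigin Γ).IsMaximal := by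
  have hker : Ideal.span (Set.range (X : Fin k → MvPolynomial (Fin k) K)) =
      RingHom.ker (constantCoeff : MvPolynomial (Fin k) K →+* K) := by
    ext f
    rw [← Set.image_univ, mem_ideal_span_X_image, RingHom.mem_ker, constantCoeff_eq]
    constructor
    · intro h
      by_contra hne
      obtain ⟨i, -, hi⟩ := h 0 (mem_support_iff.mpr hne)
      exact hi rfl
    · intro h d hd
      by_contra! hcon
      have hd0 : d = 0 := Finsupp.ext fun i => hcon i (Set.mem_univ i)
      exact mem_support_iff.mp hd (hd0 ▸ h)
  have hM : (Ideal.span (Set.range (X : Fin k → MvPolynomial (Fin k) K))).IsMaximal := by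
    rw [hker]
    exact RingHom.ker_isMaximal_of_surjective _ fun c => ⟨C c, by simp⟩
  have hle : D.fiberIdeal Γ ≤ Ideal.span (Set.range (X : Fin k → MvPolynomial (Fin k) K)) := by
    rw [hker, fiberIdeal, Ideal.map_le_iff_le_comap]
    intro f hf
    rw [Ideal.mem_comap, RingHom.mem_ker, constantCoeff_map, D.constantCoeff_eq_zero hf, map_zero]
  exact Ideal.IsMaximal.map_of_surjective_of_ker_le (f := D.fiberMk Γ)
    Ideal.Quotient.mk_surjective (by exact (Ideal.mk_ker (I := D.fiberIdeal Γ)).trans_le hle)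

/-- The local ring `R_{F_Γ}` of the fiber over `Γ` at its origin. -/
abbrev FiberRing (D : PositiveAlgebra K m k) (Γ : Fin m → K) : Type _ :=
  Localization.AtPrime (D.fiberOrigin Γ)

end PositiveAlgebra

end

noncomputable section

/-! ### Cotangent spaces at rational points -/

/-! Homogeneity and positivity of the weights enter only through `constantCoeff_eq_zero`: elements
of `I` have no constant term in the `x i`, so setting all `x i` to zero gives a retraction `R → A`
of the structure map. The zero point is the preimage under this retraction of the maximal ideal `p`
of `Γ` in `A`, and the fiber ring is `R / pR`.

Two facts then carry the theorem. The retraction splits the cotangent space at the zero point as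
that of `A` at `Γ`, of dimension `m`, times that of the fiber (`cotDim_eq_add_of_retract`,
`cotDim_zeroPoint`). The fiber inequality for heights gives `d_{Γ₀} ≤ m + d_{F_Γ}`
(`localDim_zeroPointRing_le`). Both points are `K`-rational, so localizing keeps the cotangent
spaces (`edim_atPrime_eq_cotDim`), and `localDim_le_edim` makes `ecod` of the fiber nonnegative. The
rest is integer arithmetic. -/

theorem le_comap_toAlgHom_maximalIdeal (K : Type*) {S : Type*} [CommRing K] [CommRing S]
    [Algebra K S] (p : Ideal S) [p.IsPrime] :
    p ≤ (IsLocalRing.maximalIdeal (Localization.AtPrime p)).comap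
      (IsScalarTower.toAlgHom K S (Localization.AtPrime p)) :=
  (Localization.AtPrime.under_maximalIdeal (I := p)).ge

/-- If every element of `S` is congruent modulo `p` to a scalar from `K`, then localizing at `p`
does not change the cotangent space. -/
theorem mapCotangent_atPrime_bijective {K S : Type*} [Field K] [CommRing S] [Algebra K S]
    (p : Ideal S) [p.IsPrime] (hK : ∀ x : S, ∃ c : K, x - algebraMap K S c ∈ p) :
    Function.Bijective (Ideal.mapCotangent p
      (IsLocalRing.maximalIdeal (Localization.AtPrime p))
      (IsScalarTower.toAlgHom K S (Localization.AtPrime p))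
      (le_comap_toAlgHom_maximalIdeal K p)) := by
  set L := Localization.AtPrime p
  have hmax : p.map (algebraMap S L) = IsLocalRing.maximalIdeal L :=
    Localization.AtPrime.map_eq_maximalIdeal
  have hinv : ∀ s : S, s ∉ p → ∃ c : K, c ≠ 0 ∧ s - algebraMap K S c ∈ p := by
    intro s hs
    obtain ⟨c, hc⟩ := hK s
    refine ⟨c, ?_, hc⟩
    rintro rfl
    simp [hs] at hc
  constructor
  · rw [injective_iff_map_eq_zero]
    intro z hz
    obtain ⟨⟨x, hx⟩, rfl⟩ := p.toCotangent_surjective z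
    rw [Ideal.mapCotangent_toCotangent, Ideal.toCotangent_eq_zero] at hz
    change algebraMap S L x ∈ _ at hz
    rw [← hmax, ← Ideal.map_pow, IsLocalization.algebraMap_mem_map_algebraMap_iff p.primeCompl] at hz
    obtain ⟨s, hs, hsx⟩ := hz
    obtain ⟨c, hc, hsc⟩ := hinv s hs
    rw [Ideal.toCotangent_eq_zero]
    change x ∈ p ^ 2
    -- Modulo `p ^ 2`, multiplying `x ∈ p` by `s` is the same as multiplying it by the nonzero
    -- scalar `c`.
    have h1 : algebraMap K S c * x ∈ p ^ 2 := by
      have : algebraMap K S c * x = s * x - (s - algebraMap K S c) * x := by ring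
      rw [this]
      exact sub_mem hsx (by rw [sq]; exact Ideal.mul_mem_mul hsc hx)
    have h2 : x = algebraMap K S c⁻¹ * (algebraMap K S c * x) := by
      rw [← mul_assoc, ← map_mul, inv_mul_cancel₀ hc, map_one, one_mul]
    rw [h2]
    exact Ideal.mul_mem_left _ _ h1
  · intro z
    obtain ⟨⟨y, hy⟩, rfl⟩ := (IsLocalRing.maximalIdeal L).toCotangent_surjective z
    obtain ⟨x, s, rfl⟩ := IsLocalization.exists_mk'_eq p.primeCompl y
    have hx : x ∈ p := by
      rwa [IsLocalization.AtPrime.mk'_mem_maximal_iff (S := L) (I := p)] at hy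
    obtain ⟨c, hc, hsc⟩ := hinv s s.2
    -- The fraction `x / s` is replaced by `c⁻¹ x`; the difference is `c⁻¹ (s - c) · (x / s)`, a
    -- product of two elements of the maximal ideal.
    refine ⟨p.toCotangent ⟨algebraMap K S c⁻¹ * x, Ideal.mul_mem_left _ _ hx⟩, ?_⟩
    rw [Ideal.mapCotangent_toCotangent, Ideal.toCotangent_eq]
    change algebraMap S L (algebraMap K S c⁻¹ * x) - _ ∈ _
    have key : algebraMap S L (algebraMap K S c⁻¹ * x) - IsLocalization.mk' L x s =
        algebraMap S L (algebraMap K S c⁻¹ * (s - algebraMap K S c)) *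
          IsLocalization.mk' L x s := by
      rw [mul_sub, ← map_mul (algebraMap K S), inv_mul_cancel₀ hc, map_one, map_sub, map_one,
        sub_mul, one_mul, map_mul, map_mul, mul_assoc, IsLocalization.mk'_spec'_mk]
    rw [key, sq]
    refine Ideal.mul_mem_mul ?_ hy
    rw [← hmax]
    exact Ideal.mem_map_of_mem _ (Ideal.mul_mem_left _ _ hsc)

theorem edim_atPrime_eq_cotDim {K S : Type*} [Field K] [CommRing S] [Algebra K S]
    (p : Ideal S) [p.IsPrime] (hK : ∀ x : S, ∃ c : K, x - algebraMap K S c ∈ p) :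
    edim K (Localization.AtPrime p) = cotDim K p :=
  (LinearEquiv.ofBijective _ (mapCotangent_atPrime_bijective p hK)).finrank_eq.symm

/-- The dimension of a Noetherian local `K`-algebra with residue field `K` is at most its
embedding dimension. -/
theorem localDim_le_edim {K S : Type*} [Field K] [CommRing S] [Algebra K S] [IsLocalRing S]
    [IsNoetherianRing S]
    (hK : Function.Surjective (algebraMap K (IsLocalRing.ResidueField S))) :
    localDim S ≤ edim K S := by
  have h1 : (localDim S : WithBot ℕ∞) ≤ (IsLocalRing.maximalIdeal S).spanFinrank := by
    rw [coe_localDim]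
    exact ringKrullDim_le_spanFinrank_maximalIdeal S
  have h2 : localDim S ≤ (IsLocalRing.maximalIdeal S).spanFinrank := by exact_mod_cast h1
  refine h2.trans_eq ?_
  rw [IsLocalRing.spanFinrank_maximalIdeal_eq_finrank_cotangentSpace, edim, cotDim]
  -- The number of generators is a dimension over the residue field; a residue extension of degree
  -- one turns it into a dimension over `K`.
  have h3 : Module.finrank K (IsLocalRing.ResidueField S) = 1 := by
    rw [← Module.finrank_self K]
    exact (LinearEquiv.ofBijective (Algebra.linearMap K (IsLocalRing.ResidueField S))
      ⟨(algebraMap K _).injective, hK⟩).finrank_eq.symm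
  have : IsScalarTower K (IsLocalRing.ResidueField S) (IsLocalRing.CotangentSpace S) := by
    refine ⟨fun c x y => ?_⟩
    obtain ⟨x, rfl⟩ := IsLocalRing.residue_surjective x
    rw [Algebra.smul_def, mul_smul, IsScalarTower.algebraMap_apply K S,
      IsLocalRing.ResidueField.algebraMap_eq]
    rw [← IsLocalRing.ResidueField.algebraMap_eq, algebraMap_smul, algebraMap_smul, algebraMap_smul]
  have h4 := Module.finrank_mul_finrank K (IsLocalRing.ResidueField S)
    (IsLocalRing.CotangentSpace S)
  rw [h3, one_mul] at h4
  exact h4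

/-- A `K`-algebra with a retraction onto `A` and a compatible quotient `F`, the fiber over a
rational point of `A`, has as cotangent space the product of those of `A` and `F`. -/
theorem cotDim_eq_add_of_retract {K A S F : Type*} [Field K] [CommRing A] [CommRing S]
    [CommRing F] [Algebra K A] [Algebra K S] [Algebra K F] {p : Ideal A} {P : Ideal S} {q : Ideal F}
    (i : A →ₐ[K] S) (r : S →ₐ[K] A) (π : S →ₐ[K] F) (hr : ∀ a, r (i a) = a)
    (hi : p ≤ P.comap i) (hrP : P ≤ p.comap r) (hq : P.map π = q)
    (hπ : Function.Surjective π) (hker : RingHom.ker π = p.map i)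
    (hK : ∀ x : S, ∃ c : K, x - algebraMap K S c ∈ P)
    [Module.Finite K p.Cotangent] [Module.Finite K q.Cotangent] :
    cotDim K P = cotDim K p + cotDim K q := by
  subst hq
  have hπP : P ≤ (P.map π).comap π := Ideal.le_comap_map
  have hpi : ∀ a ∈ p, π (i a) = 0 := fun a ha => by
    rw [← RingHom.mem_ker, hker]
    exact Ideal.mem_map_of_mem _ ha
  -- Modulo `P ^ 2` a coefficient `t` acts on `i a ∈ P` through its scalar value `c`, so the
  -- extended ideal adds nothing beyond the image of `p`.
  have hpS : ∀ x ∈ p.map i, ∃ a ∈ p, x - i a ∈ P ^ 2 := by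
    intro x hx
    refine Submodule.span_induction ?_ ⟨0, p.zero_mem, by simp⟩ ?_ ?_ hx
    · rintro _ ⟨a, ha, rfl⟩
      exact ⟨a, ha, by simp⟩
    · rintro x y - - ⟨a, ha, hxa⟩ ⟨b, hb, hyb⟩
      refine ⟨a + b, add_mem ha hb, ?_⟩
      rw [map_add, add_sub_add_comm]
      exact add_mem hxa hyb
    · rintro t x - ⟨a, ha, hxa⟩
      obtain ⟨c, hc⟩ := hK t
      refine ⟨algebraMap K A c * a, Ideal.mul_mem_left _ _ ha, ?_⟩
      have : t • x - i (algebraMap K A c * a) =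
          t * (x - i a) + (t - algebraMap K S c) * i a := by
        rw [map_mul, AlgHom.commutes, smul_eq_mul]; ring
      rw [this]
      refine add_mem (Ideal.mul_mem_left _ _ hxa) ?_
      rw [sq]
      exact Ideal.mul_mem_mul hc (hi ha)
  let φ : P.Cotangent →ₗ[K] p.Cotangent × (P.map π).Cotangent :=
    (Ideal.mapCotangent P p r hrP).prod (Ideal.mapCotangent P (P.map π) π hπP)
  have hφ : Function.Bijective φ := by
    constructor
    · rw [injective_iff_map_eq_zero]
      intro z hz
      obtain ⟨⟨x, hx⟩, rfl⟩ := P.toCotangent_surjective z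
      obtain ⟨h1, h2⟩ := Prod.ext_iff.mp hz
      change Ideal.mapCotangent P p r hrP _ = 0 at h1
      change Ideal.mapCotangent P (P.map π) π hπP _ = 0 at h2
      rw [Ideal.mapCotangent_toCotangent, Ideal.toCotangent_eq_zero] at h1 h2
      change r x ∈ p ^ 2 at h1
      change π x ∈ (P.map π) ^ 2 at h2
      rw [Ideal.toCotangent_eq_zero]
      change x ∈ P ^ 2
      rw [← Ideal.map_pow, Ideal.mem_map_iff_of_surjective _ hπ] at h2
      obtain ⟨y, hy, hyx⟩ := h2
      have hxy : x - y ∈ p.map i := by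
        rw [← hker, RingHom.mem_ker, map_sub, hyx, sub_self]
      obtain ⟨a, -, ha⟩ := hpS _ hxy
      have hx' : x - i a ∈ P ^ 2 := by
        have : x - i a = (x - y - i a) + y := by ring
        rw [this]
        exact add_mem ha hy
      have hr2 : (P ^ 2).map r ≤ p ^ 2 := by
        rw [Ideal.map_pow]
        exact Ideal.pow_right_mono (Ideal.map_le_iff_le_comap.mpr hrP) 2
      have hi2 : (p ^ 2).map i ≤ P ^ 2 := by
        rw [Ideal.map_pow]
        exact Ideal.pow_right_mono (Ideal.map_le_iff_le_comap.mpr hi) 2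
      -- Applying `r` to `x - i a ∈ P ^ 2` gives `r x - a ∈ p ^ 2`, and `r x ∈ p ^ 2` is already
      -- known.
      have ha2 : a ∈ p ^ 2 := by
        have h3 := hr2 (Ideal.mem_map_of_mem r hx')
        rw [map_sub, hr] at h3
        exact (Submodule.sub_mem_iff_right _ h1).mp h3
      exact (Submodule.sub_mem_iff_left _ (hi2 (Ideal.mem_map_of_mem i ha2))).mp hx'
    · rintro ⟨u, v⟩
      obtain ⟨⟨a, ha⟩, rfl⟩ := p.toCotangent_surjective u
      obtain ⟨⟨y, hy⟩, rfl⟩ := (P.map π).toCotangent_surjective v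
      obtain ⟨x, hx, rfl⟩ := (Ideal.mem_map_iff_of_surjective _ hπ).mp hy
      have hir : i (r x) ∈ P := hi (hrP hx)
      -- The correction `x - i (r x)` is killed by `r` and has the same image as `x` under `π`,
      -- which kills `i a` and `i (r x)`.
      refine ⟨P.toCotangent ⟨i a + (x - i (r x)), add_mem (hi ha) (sub_mem hx hir)⟩, ?_⟩
      refine Prod.ext ?_ ?_
      · change Ideal.mapCotangent P p r hrP _ = _
        rw [Ideal.mapCotangent_toCotangent]
        congr 2
        simp [hr]
      · change Ideal.mapCotangent P (P.map π) π hπP _ = _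
        rw [Ideal.mapCotangent_toCotangent]
        congr 2
        simp [hpi a ha, hpi _ (hrP hx)]
  unfold cotDim
  rw [(LinearEquiv.ofBijective φ hφ).finrank_eq, Module.finrank_prod]

/-- The height inequality for a fiber presented by a surjection. -/
theorem height_le_height_add_height_map_of_ker_eq {A S F : Type*} [CommRing A] [IsNoetherianRing A]
    [CommRing S] [IsNoetherianRing S] [CommRing F] (i : A →+* S) (π : S →+* F) (p : Ideal A)
    [p.IsPrime] (P : Ideal S) [P.IsPrime] (hp : P.comap i = p) (hπ : Function.Surjective π)
    (hker : RingHom.ker π = p.map i) : P.height ≤ p.height + (P.map π).height := by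
  let := i.toAlgebra
  have : P.LiesOver p := ⟨hp.symm⟩
  refine (Ideal.height_le_height_add_of_liesOver p P).trans ?_
  let e : (S ⧸ p.map (algebraMap A S)) ≃+* F :=
    (Ideal.quotEquivOfEq hker.symm).trans (RingHom.quotientKerEquivOfSurjective hπ)
  have h : P.map π = (P.map (Ideal.Quotient.mk (p.map (algebraMap A S)))).map
      (e : _ →+* F) := by
    rw [Ideal.map_map]
    rfl
  rw [h]
  exact add_le_add_right (e.height_map _).ge _

/-! ### Rational points of affine space -/

theorem ker_eval_eq_span {K : Type*} [Field K] {m : ℕ} (Γ : Fin m → K) :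
    RingHom.ker (eval Γ) =
      Ideal.span (Set.range fun i => (X i - C (Γ i) : MvPolynomial (Fin m) K)) := by
  set J := Ideal.span (Set.range fun i => (X i - C (Γ i) : MvPolynomial (Fin m) K))
  have hJ : J ≤ RingHom.ker (eval Γ) := by
    rw [Ideal.span_le]
    rintro _ ⟨i, rfl⟩
    simp [RingHom.mem_ker]
  refine le_antisymm (fun f hf => ?_) hJ
  -- Modulo `J` each variable equals its value at `Γ`, so the quotient map factors through
  -- evaluation.
  have h : (Ideal.Quotient.mk J) = ((Ideal.Quotient.mk J).comp C).comp (eval Γ) := by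
    refine MvPolynomial.ringHom_ext (fun c => by simp) fun i => ?_
    rw [RingHom.comp_apply, eval_X, RingHom.comp_apply, Ideal.Quotient.mk_eq_mk_iff_sub_mem]
    exact Ideal.subset_span ⟨i, rfl⟩
  rw [← Ideal.Quotient.eq_zero_iff_mem, h, RingHom.comp_apply, hf, map_zero]

/-- The partial derivative at a rational point, as a functional on the cotangent space. -/
def cotangentPDeriv {K : Type*} [Field K] {m : ℕ} (Γ : Fin m → K) (i : Fin m) :
    (RingHom.ker (eval Γ)).Cotangent →ₗ[K] K :=
  Ideal.Cotangent.lift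
    ((aeval Γ : MvPolynomial (Fin m) K →ₐ[K] K).toLinearMap ∘ₗ
      (pderiv i : Derivation K _ (MvPolynomial (Fin m) K)).toLinearMap ∘ₗ
      ((RingHom.ker (eval Γ)).restrictScalars K).subtype) <| by
    rintro ⟨x, hx⟩ ⟨y, hy⟩
    rw [RingHom.mem_ker] at hx hy
    change aeval Γ (pderiv i (x * y)) = 0
    simp [Derivation.leibniz, aeval_eq_eval, hx, hy]

theorem cotangentPDeriv_toCotangent {K : Type*} [Field K] {m : ℕ} (Γ : Fin m → K) (i : Fin m)
    (x : RingHom.ker (eval Γ)) :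
    cotangentPDeriv Γ i ((RingHom.ker (eval Γ)).toCotangent x) =
      eval Γ (pderiv i (x : MvPolynomial (Fin m) K)) :=
  rfl

theorem X_sub_C_mem_ker_eval {K : Type*} [Field K] {m : ℕ} (Γ : Fin m → K) (i : Fin m) :
    (X i - C (Γ i) : MvPolynomial (Fin m) K) ∈ RingHom.ker (eval Γ) := by
  simp [RingHom.mem_ker]

/-- The linear map from `K ^ m` onto the cotangent space of affine space at a rational point. -/
def cotangentOfPoint {K : Type*} [Field K] {m : ℕ} (Γ : Fin m → K) :
    (Fin m → K) →ₗ[K] (RingHom.ker (eval Γ)).Cotangent :=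
  Fintype.linearCombination K fun i =>
    (RingHom.ker (eval Γ)).toCotangent ⟨_, X_sub_C_mem_ker_eval Γ i⟩

/-- The partial derivatives at `Γ` are dual to the classes of `X i - C (Γ i)`. -/
theorem cotangentOfPoint_injective {K : Type*} [Field K] {m : ℕ} (Γ : Fin m → K) :
    Function.Injective (cotangentOfPoint Γ) := by
  refine Function.LeftInverse.injective
    (g := fun z i => cotangentPDeriv Γ i z) fun c => funext fun j => ?_
  change cotangentPDeriv Γ j (cotangentOfPoint Γ c) = c j
  rw [cotangentOfPoint, Fintype.linearCombination_apply, map_sum]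
  simp_rw [map_smul, cotangentPDeriv_toCotangent]
  rw [Finset.sum_eq_single j]
  · simp
  · intro i _ hij
    simp [pderiv_X_of_ne hij]
  · simp

theorem cotangentOfPoint_surjective {K : Type*} [Field K] {m : ℕ} (Γ : Fin m → K) :
    Function.Surjective (cotangentOfPoint Γ) := by
  intro z
  obtain ⟨⟨x, hx⟩, rfl⟩ := (RingHom.ker (eval Γ)).toCotangent_surjective z
  have hx' := hx
  rw [ker_eval_eq_span, Ideal.mem_span_range_iff_exists_fun] at hx'
  obtain ⟨c, rfl⟩ := hx'
  refine ⟨fun i => eval Γ (c i), ?_⟩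
  have : (⟨∑ i, c i * (X i - C (Γ i)), hx⟩ : RingHom.ker (eval Γ)) =
      ∑ i, c i • ⟨_, X_sub_C_mem_ker_eval Γ i⟩ := by
    ext1
    simp
  rw [this, map_sum, cotangentOfPoint, Fintype.linearCombination_apply]
  refine Finset.sum_congr rfl fun i _ => ?_
  -- The ideal annihilates its cotangent space, so `c i` acts as the scalar `eval Γ (c i)`.
  rw [map_smul, ← algebraMap_smul (MvPolynomial (Fin m) K) (eval Γ (c i)), ← sub_eq_zero,
    ← sub_smul]
  exact Ideal.Cotangent.smul_eq_zero_of_mem (by simp [RingHom.mem_ker]) _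

/-- The cotangent space of affine space at a rational point. -/
def cotangentEquivOfPoint {K : Type*} [Field K] {m : ℕ} (Γ : Fin m → K) :
    (Fin m → K) ≃ₗ[K] (RingHom.ker (eval Γ)).Cotangent :=
  LinearEquiv.ofBijective (cotangentOfPoint Γ)
    ⟨cotangentOfPoint_injective Γ, cotangentOfPoint_surjective Γ⟩

theorem cotDim_ker_eval {K : Type*} [Field K] {m : ℕ} (Γ : Fin m → K) :
    cotDim K (RingHom.ker (eval Γ)) = m := by
  rw [cotDim, ← (cotangentEquivOfPoint Γ).finrank_eq, Module.finrank_fin_fun]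

theorem height_ker_eval_le {K : Type*} [Field K] {m : ℕ} (Γ : Fin m → K) :
    (RingHom.ker (eval Γ)).height ≤ m := by
  have h := Ideal.height_le_ringKrullDim_of_ne_top (I := RingHom.ker (eval Γ))
    (RingHom.ker_ne_top _)
  rw [MvPolynomial.ringKrullDim_of_isNoetherianRing, ringKrullDim_eq_zero_of_field, zero_add] at h
  rw [Nat.card_fin] at h
  exact_mod_cast h

/-! ### The fiber of a positive algebra -/

theorem residueField_atPrime_algebraMap_surjective {K S : Type*} [Field K] [CommRing S]
    [Algebra K S] (p : Ideal S) [p.IsMaximal] (hK : ∀ x : S, ∃ c : K, x - algebraMap K S c ∈ p) :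
    Function.Surjective
      (algebraMap K (IsLocalRing.ResidueField (Localization.AtPrime p))) := by
  intro z
  obtain ⟨x, rfl⟩ := (Ideal.bijective_algebraMap_quotient_residueField p).surjective z
  obtain ⟨x, rfl⟩ := Ideal.Quotient.mk_surjective x
  obtain ⟨c, hc⟩ := hK x
  refine ⟨c, ?_⟩
  rw [← Ideal.Quotient.eq_zero_iff_mem, map_sub, sub_eq_zero] at hc
  rw [hc]
  rfl

/-- Finiteness matters because `Module.finrank` is zero on infinite-dimensional spaces, where
additivity over products could fail. -/
theorem finite_cotangent_of_rational {K S : Type*} [Field K] [CommRing S] [Algebra K S]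
    [IsNoetherianRing S] (p : Ideal S) (hK : ∀ x : S, ∃ c : K, x - algebraMap K S c ∈ p) :
    Module.Finite K p.Cotangent := by
  have h1 : Module.Finite K (S ⧸ p) := by
    refine Module.Finite.of_surjective (Algebra.linearMap K (S ⧸ p)) fun x => ?_
    obtain ⟨x, rfl⟩ := Ideal.Quotient.mk_surjective x
    obtain ⟨c, hc⟩ := hK x
    refine ⟨c, ?_⟩
    rw [← Ideal.Quotient.eq_zero_iff_mem, map_sub, sub_eq_zero] at hc
    rw [hc]
    rfl
  have : Module.Finite S p := Module.Finite.iff_fg.mpr p.fg_of_isNoetherianRing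
  have : Module.Finite S p.Cotangent := Module.Finite.of_surjective _ p.toCotangent_surjective
  have h2 : Module.Finite (S ⧸ p) p.Cotangent := Module.Finite.of_restrictScalars_finite S _ _
  have h3 : IsScalarTower K (S ⧸ p) p.Cotangent := by
    refine ⟨fun c x y => ?_⟩
    obtain ⟨x, rfl⟩ := Ideal.Quotient.mk_surjective x
    rw [Algebra.smul_def, mul_smul, IsScalarTower.algebraMap_apply K S,
      algebraMap_smul, algebraMap_smul]
  exact Module.Finite.trans (S ⧸ p) _

namespace PositiveAlgebra

variable {K : Type*} [Field K] {m k : ℕ} (D : PositiveAlgebra K m k) (Γ : Fin m → K)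

/-! ### Structure map, retraction and restriction to the fiber -/

instance : IsNoetherianRing D.CoordRing :=
  inferInstanceAs (IsNoetherianRing (TotalRing K m k ⧸ D.ideal))

instance : IsNoetherianRing (D.FiberCoordRing Γ) :=
  inferInstanceAs (IsNoetherianRing (MvPolynomial (Fin k) K ⧸ D.fiberIdeal Γ))

/-- The structure map `A → R`. -/
def baseInclusion : BaseRing K m →ₐ[K] D.CoordRing where
  __ := D.quotMk.comp C
  commutes' _ := rfl

/-- The retraction `R → A` setting all `x i` to zero. -/
def baseRetraction : D.CoordRing →ₐ[K] BaseRing K m where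
  __ := Ideal.Quotient.lift D.ideal constantCoeff fun _ hf => D.constantCoeff_eq_zero hf
  commutes' c := constantCoeff_C (Fin k) (C c : BaseRing K m)

theorem baseRetraction_quotMk (f : TotalRing K m k) :
    D.baseRetraction (D.quotMk f) = constantCoeff f :=
  rfl

/-- The restriction map from the coordinate ring to that of the fiber over `Γ`. -/
def toFiber : D.CoordRing →ₐ[K] D.FiberCoordRing Γ where
  __ := Ideal.quotientMap (D.fiberIdeal Γ) (MvPolynomial.map (eval Γ)) Ideal.le_comap_map
  commutes' c := by
    change D.fiberMk Γ (MvPolynomial.map (eval Γ) (C (C c))) = D.fiberMk Γ (C c)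
    simp

theorem toFiber_quotMk (f : TotalRing K m k) :
    D.toFiber Γ (D.quotMk f) = D.fiberMk Γ (MvPolynomial.map (eval Γ) f) :=
  rfl

theorem map_eval_surjective :
    Function.Surjective (MvPolynomial.map (eval Γ) : TotalRing K m k →+* MvPolynomial (Fin k) K) :=
  map_surjective _ fun c => ⟨C c, eval_C c⟩

theorem quotMk_surjective : Function.Surjective D.quotMk :=
  Ideal.Quotient.mk_surjective

theorem toFiber_surjective : Function.Surjective (D.toFiber Γ) := by
  intro y
  obtain ⟨g, rfl⟩ := Ideal.Quotient.mk_surjective y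
  obtain ⟨f, rfl⟩ := map_eval_surjective Γ g
  exact ⟨D.quotMk f, rfl⟩

theorem ker_toFiber : RingHom.ker (D.toFiber Γ) =
    (RingHom.ker (eval Γ)).map D.baseInclusion := by
  refine le_antisymm (fun x hx => ?_) ?_
  · obtain ⟨f, rfl⟩ := D.quotMk_surjective x
    rw [RingHom.mem_ker, toFiber_quotMk] at hx
    have hx' : MvPolynomial.map (eval Γ) f ∈ D.fiberIdeal Γ := Ideal.Quotient.eq_zero_iff_mem.mp hx
    rw [fiberIdeal, Ideal.mem_map_iff_of_surjective _ (map_eval_surjective Γ)] at hx'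
    obtain ⟨g, hg, hgf⟩ := hx'
    have h1 : f - g ∈ RingHom.ker
        (MvPolynomial.map (eval Γ) : TotalRing K m k →+* MvPolynomial (Fin k) K) := by
      rw [RingHom.mem_ker, map_sub, hgf, sub_self]
    -- The kernel of coefficientwise evaluation is extended from `A`; subtracting `g ∈ I` does not
    -- change the class in `R`.
    rw [MvPolynomial.ker_map] at h1
    have h2 := Ideal.mem_map_of_mem D.quotMk h1
    have hg0 : D.quotMk g = 0 := Ideal.Quotient.eq_zero_iff_mem.mpr hg
    rw [map_sub, hg0, sub_zero, Ideal.map_map] at h2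
    exact h2
  · rw [Ideal.map_le_iff_le_comap]
    intro a ha
    rw [Ideal.mem_comap, RingHom.mem_ker]
    change D.fiberMk Γ (MvPolynomial.map (eval Γ) (C a)) = 0
    rw [map_C, RingHom.mem_ker.mp ha, map_zero, map_zero]

/-! ### The zero point and the origin of the fiber -/

theorem evalZeroPoint_apply (f : TotalRing K m k) :
    evalZeroPoint k Γ f = eval Γ (constantCoeff f) := by
  rw [← eval_zero]
  rfl

theorem zeroPoint_eq_comap :
    D.zeroPoint Γ = (RingHom.ker (eval Γ)).comap D.baseRetraction := by
  -- The zero point is maximal, so one inclusion into a proper ideal suffices.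
  have : (RingHom.ker (eval Γ)).IsPrime := RingHom.ker_isPrime _
  refine Ideal.IsMaximal.eq_of_le inferInstance (Ideal.IsPrime.comap _).ne_top ?_
  rw [zeroPoint, Ideal.map_le_iff_le_comap]
  intro f hf
  rw [zeroPointIdeal, RingHom.mem_ker, evalZeroPoint_apply] at hf
  rwa [Ideal.mem_comap, Ideal.mem_comap, baseRetraction_quotMk, RingHom.mem_ker]

theorem baseRetraction_baseInclusion (a : BaseRing K m) :
    D.baseRetraction (D.baseInclusion a) = a :=
  constantCoeff_C (Fin k) a

theorem comap_baseInclusion_zeroPoint :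
    (D.zeroPoint Γ).comap D.baseInclusion = RingHom.ker (eval Γ) := by
  ext a
  rw [Ideal.mem_comap, zeroPoint_eq_comap, Ideal.mem_comap, baseRetraction_baseInclusion]

theorem exists_sub_algebraMap_mem_zeroPoint (x : D.CoordRing) :
    ∃ c : K, x - algebraMap K D.CoordRing c ∈ D.zeroPoint Γ := by
  refine ⟨eval Γ (D.baseRetraction x), ?_⟩
  rw [zeroPoint_eq_comap, Ideal.mem_comap, RingHom.mem_ker, map_sub, AlgHom.commutes, map_sub,
    algebraMap_eq, eval_C, sub_self]

theorem map_toFiber_zeroPoint : (D.zeroPoint Γ).map (D.toFiber Γ) = D.fiberOrigin Γ := by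
  have hker : RingHom.ker (D.toFiber Γ) ≤ D.zeroPoint Γ := by
    rw [ker_toFiber, Ideal.map_le_iff_le_comap, comap_baseInclusion_zeroPoint]
  have hmax : ((D.zeroPoint Γ).map (D.toFiber Γ)).IsMaximal :=
    Ideal.IsMaximal.map_of_surjective_of_ker_le (D.toFiber_surjective Γ) hker
  refine (Ideal.IsMaximal.eq_of_le inferInstance hmax.ne_top ?_).symm
  rw [fiberOrigin, Ideal.map_span, Ideal.span_le]
  rintro _ ⟨_, ⟨i, rfl⟩, rfl⟩
  have hX : D.quotMk (X i) ∈ D.zeroPoint Γ := by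
    refine Ideal.mem_map_of_mem _ ?_
    simp [zeroPointIdeal, RingHom.mem_ker, evalZeroPoint]
  have h := Ideal.mem_map_of_mem (D.toFiber Γ) hX
  rwa [toFiber_quotMk, map_X] at h

theorem exists_sub_algebraMap_mem_fiberOrigin (x : D.FiberCoordRing Γ) :
    ∃ c : K, x - algebraMap K (D.FiberCoordRing Γ) c ∈ D.fiberOrigin Γ := by
  obtain ⟨y, rfl⟩ := D.toFiber_surjective Γ x
  obtain ⟨c, hc⟩ := D.exists_sub_algebraMap_mem_zeroPoint Γ y
  refine ⟨c, ?_⟩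
  rw [← AlgHom.commutes (D.toFiber Γ), ← map_sub, ← map_toFiber_zeroPoint]
  exact Ideal.mem_map_of_mem _ hc

/-! ### Comparison of cotangent and Krull dimensions -/

theorem cotDim_zeroPoint : cotDim K (D.zeroPoint Γ) = m + cotDim K (D.fiberOrigin Γ) := by
  have := finite_cotangent_of_rational _ (D.exists_sub_algebraMap_mem_fiberOrigin Γ)
  have := Module.Finite.equiv (cotangentEquivOfPoint Γ)
  rw [cotDim_eq_add_of_retract D.baseInclusion D.baseRetraction (D.toFiber Γ)
    D.baseRetraction_baseInclusion (D.comap_baseInclusion_zeroPoint Γ).ge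
    (D.zeroPoint_eq_comap Γ).le (D.map_toFiber_zeroPoint Γ) (D.toFiber_surjective Γ)
    (D.ker_toFiber Γ) (D.exists_sub_algebraMap_mem_zeroPoint Γ), cotDim_ker_eval]

theorem localDim_zeroPointRing_le :
    localDim (D.ZeroPointRing Γ) ≤ m + localDim (D.FiberRing Γ) := by
  have : (RingHom.ker (eval Γ)).IsPrime := RingHom.ker_isPrime _
  have h := height_le_height_add_height_map_of_ker_eq
    (D.baseInclusion : BaseRing K m →+* D.CoordRing)
    (D.toFiber Γ : D.CoordRing →+* D.FiberCoordRing Γ) (RingHom.ker (eval Γ)) (D.zeroPoint Γ)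
    (D.comap_baseInclusion_zeroPoint Γ) (D.toFiber_surjective Γ) (D.ker_toFiber Γ)
  have hmap : (D.zeroPoint Γ).map (D.toFiber Γ : D.CoordRing →+* D.FiberCoordRing Γ) =
    D.fiberOrigin Γ := D.map_toFiber_zeroPoint Γ
  rw [hmap] at h
  have h' := h.trans (add_le_add_left (height_ker_eval_le Γ) _)
  have h1 : ((localDim (D.ZeroPointRing Γ) : ℕ∞) : WithBot ℕ∞) = (D.zeroPoint Γ).height :=
    (coe_localDim (D.ZeroPointRing Γ)).trans (IsLocalization.AtPrime.ringKrullDim_eq_height _ _)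
  have h2 : ((localDim (D.FiberRing Γ) : ℕ∞) : WithBot ℕ∞) = (D.fiberOrigin Γ).height :=
    (coe_localDim (D.FiberRing Γ)).trans (IsLocalization.AtPrime.ringKrullDim_eq_height _ _)
  rw [← WithBot.coe_injective h1, ← WithBot.coe_injective h2] at h'
  exact_mod_cast h'

end PositiveAlgebra

end

theorem mainTheorem3 {K : Type*} [Field K] {m k : ℕ} (D : PositiveAlgebra K m k) (Γ : Fin m → K) :
    -- part (a)
    ((localDim (D.ZeroPointRing Γ) : ℤ) - m ≤ localDim (D.FiberRing Γ) ∧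
      (localDim (D.FiberRing Γ) : ℤ) = cotDim K (D.fiberOrigin Γ) - ecod K (D.FiberRing Γ) ∧
      (cotDim K (D.fiberOrigin Γ) : ℤ) - ecod K (D.FiberRing Γ) =
        cotDim K (D.zeroPoint Γ) - m - ecod K (D.FiberRing Γ) ∧
      (cotDim K (D.zeroPoint Γ) : ℤ) - m - ecod K (D.FiberRing Γ) =
        edim K (D.ZeroPointRing Γ) - m - ecod K (D.FiberRing Γ) ∧
      (edim K (D.ZeroPointRing Γ) : ℤ) - m - ecod K (D.FiberRing Γ) =
        localDim (D.ZeroPointRing Γ) + ecod K (D.ZeroPointRing Γ) - m - ecod K (D.FiberRing Γ)) ∧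
    -- part (b)
    (0 ≤ ecod K (D.FiberRing Γ) ∧ ecod K (D.FiberRing Γ) ≤ ecod K (D.ZeroPointRing Γ)) := by
 
  have h1 := D.localDim_zeroPointRing_le Γ
  have h2 := D.cotDim_zeroPoint Γ
  have h3 : edim K (D.ZeroPointRing Γ) = cotDim K (D.zeroPoint Γ) :=
    edim_atPrime_eq_cotDim _ (D.exists_sub_algebraMap_mem_zeroPoint Γ)
  have h4 : edim K (D.FiberRing Γ) = cotDim K (D.fiberOrigin Γ) :=
    edim_atPrime_eq_cotDim _ (D.exists_sub_algebraMap_mem_fiberOrigin Γ)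
  have h5 : localDim (D.FiberRing Γ) ≤ edim K (D.FiberRing Γ) :=
    localDim_le_edim (residueField_atPrime_algebraMap_surjective _
      (D.exists_sub_algebraMap_mem_fiberOrigin Γ))
  unfold ecod
  -- For the upper bound in (b), the difference of the two `ecod` is `m + d_{F_Γ} - d_{Γ₀}`, which
  -- is nonnegative by `h1`.
  omega
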